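/- Let $n\in\mathbb N$, let $F$ be a continuous real function of $(s,p,X)\in\mathbb R\times\mathbb R^n\times\mathbb R^{n\times n}$, and let $u:\mathbb R^n\to\mathbb R$ be an entire solution of $F(u,\nabla u,\nabla^2u)=0$ such that $u\in C^2(\mathbb R^n)\cap L^\infty(\mathbb R^n)$, $\nabla u\in C^\alpha(\mathbb R^n;\mathbb R^n)$ (globally Hölder) for some $\alpha\in(0,1)$, and $|\nabla u|\le C$ on $\mathbb R^n$ for some constant $C>0$. Let $B\in C([0,\infty))\cap C^2((0,\infty))$ with $B(0)=0$, $B'(t)>0$ and $B''(t)\ge 0$ for $t>0$, and let $\Gamma:\mathbb R\to[0,\infty)$ be such that $\Psi:=B^{-1}\circ\Gamma$ is of class $C^2$ on $\mathbb R$, where $B^{-1}:[0,\infty)\to[0,\infty)$ is the inverse of $B$ on $[0,\infty)$. Put $P(x)=B(|\nabla u(x)|^2)-\Gamma(u(x))$. Suppose that $P$ is a $P$-function with weight $\mu=\mu(|\nabla u|)$, that is: $\mu:[0,\infty)\to[0,\infty)$ with $\mu(t)>0$ for all $t>0$; $P$ is $C^2$ near each point where $\mu(|\nabla u|)>0$;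 and there is an operator $$L=-\sum_{i,j}a_{ij}(x)\,\partial_{x_ix_j}+\sum_i b_i(x)\,\partial_{x_i}+c(x),\qquad c\ge 0,$$ such that $\mu(|\nabla u|)\,LP\le 0$ on $\mathbb R^n$, and such that $L$ is uniformly elliptic on each set $\{|\nabla u|\ge\delta\}$, $\delta>0$, in the following sense: there is a constant $K=K(\delta)$ such that at every point $x$ of this set there is $\lambda(x)>0$ with $\lambda(x)|\xi|^2\le\sum_{i,j} a_{ij}(x)\xi_i\xi_j\le K\lambda(x)|\xi|^2$ for all $\xi\in\mathbb R^n$ and $|b(x)|\le K\lambda(x)$. If there is $x_0\in\mathbb R^n$ with $\Gamma(u(x_0))=0$, then $u$ is constant on $\mathbb R^n$. -/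

import Mathlib

/-- The Euclidean space `ℝⁿ`. -/
abbrev Rn (n : ℕ) : Type := EuclideanSpace ℝ (Fin n)

/-- The partial derivative `∂w/∂xᵢ`. -/
noncomputable def partialDeriv {n : ℕ} (i : Fin n) (w : Rn n → ℝ) (x : Rn n) : ℝ :=
  fderiv ℝ w x (EuclideanSpace.single i 1)

/-- The Hessian matrix `∇²w`. -/
noncomputable def hessian {n : ℕ} (w : Rn n → ℝ) (x : Rn n) : Matrix (Fin n) (Fin n) ℝ :=
  Matrix.of fun i j => partialDeriv i (partialDeriv j w) x

/-- `u` is an entire (classical) solution of `F(u, ∇u, ∇²u) = 0`. -/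
def IsEntireSolution {n : ℕ} (F : ℝ × Rn n × Matrix (Fin n) (Fin n) ℝ → ℝ)
    (u : Rn n → ℝ) : Prop :=
  ContDiff ℝ 2 u ∧ ∀ x, F (u x, gradient u x, hessian u x) = 0

/-- The standing assumption: `u ∈ C²(ℝⁿ) ∩ L^∞(ℝⁿ)`, `∇u ∈ C^α(ℝⁿ; ℝⁿ)` for some `α ∈ (0,1)`,
and `|∇u| ≤ C` on `ℝⁿ`. -/
structure StandingAssumption {n : ℕ} (u : Rn n → ℝ) : Prop where
  contDiff : ContDiff ℝ 2 u
  bounded : ∃ M : ℝ, ∀ x, |u x| ≤ M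
  holder : ∃ (α K : NNReal), 0 < α ∧ α < 1 ∧ HolderWith K α (gradient u)
  gradient_bounded : ∃ C : ℝ, 0 < C ∧ ∀ x, ‖gradient u x‖ ≤ C

/-- The coefficients of `L = - ∑ aᵢⱼ ∂ᵢⱼ + ∑ bᵢ ∂ᵢ + c`. -/
structure SecondOrderOperator (n : ℕ) where
  a : Rn n → Matrix (Fin n) (Fin n) ℝ
  b : Rn n → Rn n
  c : Rn n → ℝ

/-- `L w = - ∑ aᵢⱼ ∂ᵢⱼ w + ∑ bᵢ ∂ᵢ w + c w`. -/
noncomputable def SecondOrderOperator.apply {n : ℕ} (L : SecondOrderOperator n)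
    (w : Rn n → ℝ) (x : Rn n) : ℝ :=
  - (∑ i, ∑ j, L.a x i j * hessian w x i j) + (∑ i, L.b x i * partialDeriv i w x) + L.c x * w x

/-- `L` is uniformly elliptic on `S`: with a positive ellipticity `l(x)`, the ratio of the largest
to the smallest ellipticity and `|b|/l` are bounded on `S`. -/
def SecondOrderOperator.IsUniformlyEllipticOn {n : ℕ} (L : SecondOrderOperator n)
    (S : Set (Rn n)) : Prop :=
  ∃ K : ℝ, ∀ x ∈ S, ∃ l : ℝ, 0 < l ∧ ‖L.b x‖ ≤ K * l ∧
    ∀ ξ : Rn n, l * ‖ξ‖ ^ 2 ≤ ∑ i, ∑ j, L.a x i j * ξ i * ξ j ∧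
      ∑ i, ∑ j, L.a x i j * ξ i * ξ j ≤ K * l * ‖ξ‖ ^ 2

/-- `P = P(u, ∇u)` is a `P`-function along `u`, with weight `μ = μ(|∇u|) ≥ 0`: there is an elliptic
operator `L`, with `c ≥ 0`, such that `μ(|∇u|) L P(u, ∇u) ≤ 0` on `ℝⁿ`.
Ellipticity is uniform on each set where `|∇u|` is bounded away from `0`; nothing is asked of the
leading and first order coefficients at critical points of `u`. The function `x ↦ P(u(x), ∇u(x))`
is `C²` where the weight is positive, so that `L P` is classical there. -/
def IsPFunction {n : ℕ} (u : Rn n → ℝ) (P : ℝ → Rn n → ℝ) (μ : ℝ → ℝ) : Prop :=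
  (∀ t, 0 ≤ t → 0 ≤ μ t) ∧
  (∀ x, 0 < μ ‖gradient u x‖ → ContDiffAt ℝ 2 (fun y => P (u y) (gradient u y)) x) ∧
  ∃ L : SecondOrderOperator n,
    (∀ x, 0 ≤ L.c x) ∧
    (∀ δ : ℝ, 0 < δ → L.IsUniformlyEllipticOn {x | δ ≤ ‖gradient u x‖}) ∧
    ∀ x, μ ‖gradient u x‖ * L.apply (fun y => P (u y) (gradient u y)) x ≤ 0

/-!
Suppose `P` had a positive supremum `S`. Where `P > S / 2` the gradient is bounded away from zero,
so `L` is uniformly elliptic there and `P` is a subsolution. Hopf's comparison with a Gaussian then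
spreads values of `P` close to `S`: near such a point `P > S / 2` on a ball of any prescribed radius
`R`, how close being independent of the position because `P` is uniformly continuous. But `u` is
bounded, so a large ball contains points with small gradient, a contradiction. Hence `P ≤ 0`, that
is, `|∇u|² ≤ Ψ(u)`. The nonnegative `C²` function `Ψ` vanishes to second order at its zero `u(x₀)`,
so `|∇u| ≤ C |u - u(x₀)|` and Grönwall's inequality along segments from `x₀` gives `u = u(x₀)`.
-/

open Metric Set

section SecondDerivativeTest

variable {E : Type*} [NormedAddCommGroup E] [NormedSpace ℝ E]

lemma deriv_deriv_nonpos_of_isLocalMax {f : ℝ → ℝ} {x : ℝ} (hmax : IsLocalMax f x)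
    (hf : ContinuousAt f x) : deriv (deriv f) x ≤ 0 := by
  by_contra! hpos
  have hmin : IsLocalMin f x := isLocalMin_of_deriv_deriv_pos hpos hmax.deriv_eq_zero hf
  have hconst : f =ᶠ[nhds x] fun _ => f x := by
    filter_upwards [hmax, hmin] with t h₁ h₂ using le_antisymm h₁ h₂
  have hzero : deriv (deriv f) x = 0 := by simp [hconst.deriv.deriv_eq]
  exact hpos.ne' hzero

lemma differentiableAt_fderiv_of_contDiffAt_two {w : E → ℝ} {x : E} (hw : ContDiffAt ℝ 2 w x) :
    DifferentiableAt ℝ (fderiv ℝ w) x :=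
  (hw.fderiv_right (m := 1) (by norm_num)).differentiableAt one_ne_zero

lemma deriv_deriv_comp_add_smul {w : E → ℝ} {x : E} (hw : ContDiffAt ℝ 2 w x) (ξ : E) :
    deriv (deriv fun t : ℝ => w (x + t • ξ)) 0 = fderiv ℝ (fderiv ℝ w) x ξ ξ := by
  have hline (t : ℝ) : HasDerivAt (fun t : ℝ => x + t • ξ) ξ t := by
    simpa using ((hasDerivAt_id t).smul_const ξ).const_add x
  have hline₀ : Filter.Tendsto (fun t : ℝ => x + t • ξ) (nhds 0) (nhds x) := by
    simpa using (hline 0).continuousAt.tendsto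
  have hderiv : (deriv fun t : ℝ => w (x + t • ξ)) =ᶠ[nhds 0]
      fun t => fderiv ℝ w (x + t • ξ) ξ := by
    filter_upwards [hline₀.eventually (hw.eventually (by simp))] with t ht
    exact ((ht.differentiableAt two_ne_zero).hasFDerivAt.comp_hasDerivAt t (hline t)).deriv
  have hfderiv : HasFDerivAt (fderiv ℝ w) (fderiv ℝ (fderiv ℝ w) x) (x + (0 : ℝ) • ξ) := by
    simpa using (differentiableAt_fderiv_of_contDiffAt_two hw).hasFDerivAt
  rw [hderiv.deriv_eq]
  exact ((ContinuousLinearMap.apply ℝ ℝ ξ).hasFDerivAt.comp_hasDerivAt (0 : ℝ)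
    (hfderiv.comp_hasDerivAt (0 : ℝ) (hline 0))).deriv

lemma fderiv_fderiv_apply_self_nonpos_of_isLocalMax {w : E → ℝ} {x : E}
    (hmax : IsLocalMax w x) (hw : ContDiffAt ℝ 2 w x) (ξ : E) :
    fderiv ℝ (fderiv ℝ w) x ξ ξ ≤ 0 := by
  have hline : ContinuousAt (fun t : ℝ => x + t • ξ) 0 := by fun_prop
  rw [← deriv_deriv_comp_add_smul hw]
  refine deriv_deriv_nonpos_of_isLocalMax ?_ (hw.continuousAt.comp_of_eq hline (by simp))
  exact IsLocalMax.comp_continuous (g := fun t : ℝ => x + t • ξ) (by simpa using hmax) hline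

end SecondDerivativeTest

section Hessian

variable {n : ℕ} {v w : Rn n → ℝ} {x : Rn n}

lemma partialDeriv_add (hv : DifferentiableAt ℝ v x) (hw : DifferentiableAt ℝ w x) (i : Fin n) :
    partialDeriv i (v + w) x = partialDeriv i v x + partialDeriv i w x := by
  simp [partialDeriv, fderiv_add hv hw]

lemma partialDeriv_const_smul (c : ℝ) (w : Rn n → ℝ) (i : Fin n) :
    partialDeriv i (c • w) = c • partialDeriv i w := by
  ext x
  simp [partialDeriv, fderiv_const_smul_field]

lemma hessian_apply_eq_fderiv_fderiv (hw : ContDiffAt ℝ 2 w x) (i j : Fin n) :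
    hessian w x i j =
      fderiv ℝ (fderiv ℝ w) x (EuclideanSpace.single i 1) (EuclideanSpace.single j 1) := by
  have h := (differentiableAt_fderiv_of_contDiffAt_two hw).hasFDerivAt.clm_apply
    (hasFDerivAt_const (EuclideanSpace.single j (1 : ℝ) : Rn n) x)
  change fderiv ℝ (fun y => fderiv ℝ w y (EuclideanSpace.single j 1)) x _ = _
  simp [h.fderiv]

lemma hessian_add (hv : ContDiffAt ℝ 2 v x) (hw : ContDiffAt ℝ 2 w x) :
    hessian (v + w) x = hessian v x + hessian w x := by
  have hadd : fderiv ℝ (v + w) =ᶠ[nhds x] fderiv ℝ v + fderiv ℝ w := by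
    filter_upwards [hv.eventually (by simp), hw.eventually (by simp)] with y hvy hwy
    exact fderiv_add (hvy.differentiableAt two_ne_zero) (hwy.differentiableAt two_ne_zero)
  ext i j
  rw [Matrix.add_apply, hessian_apply_eq_fderiv_fderiv (w := v + w) (hv.add hw),
    hessian_apply_eq_fderiv_fderiv hv, hessian_apply_eq_fderiv_fderiv hw, hadd.fderiv_eq,
    fderiv_add (differentiableAt_fderiv_of_contDiffAt_two hv)
      (differentiableAt_fderiv_of_contDiffAt_two hw)]
  rfl

lemma hessian_const_smul (c : ℝ) (w : Rn n → ℝ) (x : Rn n) :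
    hessian (c • w) x = c • hessian w x := by
  ext i j
  simp [hessian, partialDeriv_const_smul]

lemma posSemidef_neg_hessian_of_isLocalMax (hmax : IsLocalMax w x) (hw : ContDiffAt ℝ 2 w x) :
    (-hessian w x).PosSemidef := by
  refine Matrix.PosSemidef.of_dotProduct_mulVec_nonneg ?_ fun ξ => ?_
  · ext i j
    simpa [hessian_apply_eq_fderiv_fderiv hw] using hw.isSymmSndFDerivAt (by simp) _ _
  · have hξ : WithLp.toLp 2 ξ = ∑ i, ξ i • (EuclideanSpace.single i 1 : Rn n) := by
      ext k
      simp [Pi.single_apply]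
    have hnonpos := fderiv_fderiv_apply_self_nonpos_of_isLocalMax hmax hw (WithLp.toLp 2 ξ)
    simp only [hξ, map_sum, map_smul, sum_apply, smul_apply, smul_eq_mul,
      ← hessian_apply_eq_fderiv_fderiv hw, Finset.mul_sum] at hnonpos
    rw [Finset.sum_comm] at hnonpos
    simpa [dotProduct, Matrix.mulVec, Finset.mul_sum, mul_left_comm, mul_comm] using hnonpos

end Hessian

lemma sum_mul_nonneg_of_posSemidef {ι : Type*} [Fintype ι] {a H : Matrix ι ι ℝ}
    (ha : ∀ ξ : ι → ℝ, 0 ≤ ∑ i, ∑ j, a i j * ξ i * ξ j) (hH : H.PosSemidef) :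
    0 ≤ ∑ i, ∑ j, a i j * H i j := by
  obtain ⟨m, v, rfl⟩ := Matrix.posSemidef_iff_eq_sum_vecMulVec.mp hH
  calc (0 : ℝ) ≤ ∑ k, ∑ i, ∑ j, a i j * v k i * v k j := Finset.sum_nonneg fun k _ => ha (v k)
    _ = ∑ i, ∑ j, a i j * (∑ k, Matrix.vecMulVec (v k) (star (v k))) i j := by
      rw [Finset.sum_comm]
      refine Finset.sum_congr rfl fun i _ => ?_
      rw [Finset.sum_comm]
      simp [Matrix.sum_apply, Matrix.vecMulVec_apply, Finset.mul_sum, mul_assoc]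

namespace SecondOrderOperator

variable {n : ℕ} (L : SecondOrderOperator n)

/-- The principal symbol `∑ aᵢⱼ(x) ξᵢ ξⱼ` of `L`; it only sees the symmetric part of `a(x)`. -/
def principalSymbol (x ξ : Rn n) : ℝ := ∑ i, ∑ j, L.a x i j * ξ i * ξ j

/-- `L` is elliptic at `x`, with ellipticity ratio and relative drift `|b|/l` at most `K`: the
pointwise form of `IsUniformlyEllipticOn`. -/
def IsEllipticAt (K : ℝ) (x : Rn n) : Prop :=
  ∃ l : ℝ, 0 < l ∧ ‖L.b x‖ ≤ K * l ∧
    ∀ ξ : Rn n, l * ‖ξ‖ ^ 2 ≤ L.principalSymbol x ξ ∧ L.principalSymbol x ξ ≤ K * l * ‖ξ‖ ^ 2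

/-- `w` is a classical subsolution of `L w = 0` on `U`. -/
def IsSubsolutionOn (w : Rn n → ℝ) (U : Set (Rn n)) : Prop :=
  ∀ x ∈ U, ContDiffAt ℝ 2 w x ∧ L.apply w x ≤ 0

variable {L} {v w : Rn n → ℝ} {x y : Rn n} {K : ℝ}

lemma IsEllipticAt.principalSymbol_nonneg (h : L.IsEllipticAt K x) (ξ : Rn n) :
    0 ≤ L.principalSymbol x ξ := by
  obtain ⟨l, hl, -, hsymbol⟩ := h
  exact (by positivity : 0 ≤ l * ‖ξ‖ ^ 2).trans (hsymbol ξ).1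

lemma IsEllipticAt.const_nonneg (h : L.IsEllipticAt K x) : 0 ≤ K := by
  obtain ⟨l, hl, hb, -⟩ := h
  exact nonneg_of_mul_nonneg_left ((norm_nonneg _).trans hb) hl

variable (L) in
lemma apply_add (hv : ContDiffAt ℝ 2 v x) (hw : ContDiffAt ℝ 2 w x) :
    L.apply (v + w) x = L.apply v x + L.apply w x := by
  simp only [apply, hessian_add hv hw, Matrix.add_apply, Pi.add_apply, mul_add,
    partialDeriv_add (hv.differentiableAt two_ne_zero) (hw.differentiableAt two_ne_zero),
    Finset.sum_add_distrib]
  ring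

variable (L) in
lemma apply_const_smul (c : ℝ) (w : Rn n → ℝ) (x : Rn n) :
    L.apply (c • w) x = c * L.apply w x := by
  simp only [apply, hessian_const_smul, partialDeriv_const_smul, Matrix.smul_apply, Pi.smul_apply,
    smul_eq_mul, mul_left_comm _ c, ← Finset.mul_sum]
  ring

lemma mul_le_apply_of_isLocalMax (hmax : IsLocalMax w x) (hw : ContDiffAt ℝ 2 w x)
    (ha : ∀ ξ, 0 ≤ L.principalSymbol x ξ) : L.c x * w x ≤ L.apply w x := by
  have hsecond : 0 ≤ ∑ i, ∑ j, L.a x i j * (-hessian w x) i j :=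
    sum_mul_nonneg_of_posSemidef (fun ξ => ha (WithLp.toLp 2 ξ))
      (posSemidef_neg_hessian_of_isLocalMax hmax hw)
  have hfirst (i : Fin n) : partialDeriv i w x = 0 := by
    simp [partialDeriv, hmax.fderiv_eq_zero]
  simp only [Matrix.neg_apply, mul_neg, Finset.sum_neg_distrib] at hsecond
  simpa [apply, hfirst] using hsecond

lemma not_isLocalMax_add (hv : ContDiffAt ℝ 2 v x) (hw : ContDiffAt ℝ 2 w x)
    (ha : ∀ ξ, 0 ≤ L.principalSymbol x ξ) (hvle : L.apply v x ≤ 0) (hv₀ : 0 ≤ L.c x * v x)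
    (hwlt : L.apply w x < L.c x * w x) : ¬ IsLocalMax (v + w) x := fun hmax => by
  have hle := mul_le_apply_of_isLocalMax hmax (hv.add hw) ha
  rw [L.apply_add hv hw, Pi.add_apply, mul_add] at hle
  linarith

end SecondOrderOperator

section GaussianBarrier

variable {E : Type*} [NormedAddCommGroup E]

/-- The Gaussian `exp (-β ‖z - y‖²)` centred at `y`, Hopf's barrier for the strong maximum
principle. -/
noncomputable def gaussianBarrier (β : ℝ) (y z : E) : ℝ := Real.exp (-β * ‖z - y‖ ^ 2)

lemma gaussianBarrier_pos (β : ℝ) (y z : E) : 0 < gaussianBarrier β y z := Real.exp_pos _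

lemma gaussianBarrier_le_one {β : ℝ} (hβ : 0 ≤ β) (y z : E) : gaussianBarrier β y z ≤ 1 :=
  Real.exp_le_one_iff.2 (mul_nonpos_of_nonpos_of_nonneg (neg_nonpos.2 hβ) (sq_nonneg _))

variable [InnerProductSpace ℝ E]

lemma contDiff_gaussianBarrier (β : ℝ) (y : E) {k : WithTop ℕ∞} :
    ContDiff ℝ k (gaussianBarrier β y) :=
  (contDiff_const.mul ((contDiff_id.sub contDiff_const).norm_sq ℝ)).exp

lemma hasFDerivAt_gaussianBarrier (β : ℝ) (y z : E) :
    HasFDerivAt (gaussianBarrier β y)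
      ((-2 * β * gaussianBarrier β y z) • innerSL ℝ (z - y)) z := by
  refine ((((hasFDerivAt_id z).sub_const y).norm_sq).const_mul (-β)).exp.congr_fderiv ?_
  ext v
  simp only [gaussianBarrier, id_eq, ContinuousLinearMap.comp_id, smul_apply, coe_innerSL_apply,
    nsmul_eq_mul, Nat.cast_ofNat, smul_eq_mul]
  ring

lemma fderiv_fderiv_gaussianBarrier_apply (β : ℝ) (y z ξ η : E) :
    fderiv ℝ (fderiv ℝ (gaussianBarrier β y)) z ξ η = gaussianBarrier β y z *
      (4 * β ^ 2 * inner ℝ (z - y) ξ * inner ℝ (z - y) η - 2 * β * inner ℝ ξ η) := by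
  have hfderiv : fderiv ℝ (gaussianBarrier β y) =
      fun z => (-2 * β * gaussianBarrier β y z) • innerSL ℝ (z - y) :=
    funext fun z => (hasFDerivAt_gaussianBarrier β y z).fderiv
  have hinner : HasFDerivAt (fun z => innerSL ℝ (z - y)) (innerSL ℝ : E →L[ℝ] E →L[ℝ] ℝ) z :=
    (innerSL ℝ).hasFDerivAt.comp z ((hasFDerivAt_id z).sub_const y)
  have hsmul := ((hasFDerivAt_gaussianBarrier β y z).const_mul (-2 * β)).fun_smul hinner
  rw [hfderiv, hsmul.fderiv]
  change -2 * β * gaussianBarrier β y z * inner ℝ ξ η +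
    -2 * β * (-2 * β * gaussianBarrier β y z * inner ℝ (z - y) ξ) * inner ℝ (z - y) η = _
  ring

variable {n : ℕ}

lemma partialDeriv_gaussianBarrier (β : ℝ) (y z : Rn n) (i : Fin n) :
    partialDeriv i (gaussianBarrier β y) z = gaussianBarrier β y z * (-2 * β * (z - y) i) := by
  simp only [partialDeriv, (hasFDerivAt_gaussianBarrier β y z).fderiv, smul_apply,
    coe_innerSL_apply, EuclideanSpace.inner_single_right, Real.ringHom_apply, smul_eq_mul]
  ring

lemma hessian_gaussianBarrier (β : ℝ) (y z : Rn n) (i j : Fin n) :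
    hessian (gaussianBarrier β y) z i j = gaussianBarrier β y z *
      (4 * β ^ 2 * (z - y) i * (z - y) j - 2 * β * if i = j then 1 else 0) := by
  rw [hessian_apply_eq_fderiv_fderiv (contDiff_gaussianBarrier β y).contDiffAt,
    fderiv_fderiv_gaussianBarrier_apply]
  simp [EuclideanSpace.inner_single_right, PiLp.single_apply, eq_comm (a := j)]

namespace SecondOrderOperator

variable {L : SecondOrderOperator n} {w : Rn n → ℝ} {y z : Rn n} {K β : ℝ}

variable (L) in
lemma apply_gaussianBarrier (β : ℝ) (y z : Rn n) :
    L.apply (gaussianBarrier β y) z = gaussianBarrier β y z *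
      (-(4 * β ^ 2 * L.principalSymbol z (z - y)) + 2 * β * (L.a z).trace
        - 2 * β * inner ℝ (z - y) (L.b z) + L.c z) := by
  have hsecond : ∑ i, ∑ j, L.a z i j * hessian (gaussianBarrier β y) z i j =
      gaussianBarrier β y z *
        (4 * β ^ 2 * L.principalSymbol z (z - y) - 2 * β * (L.a z).trace) := by
    have htrace : (L.a z).trace = ∑ i, ∑ j, L.a z i j * if i = j then 1 else 0 := by
      simp [Matrix.trace]
    simp only [htrace, principalSymbol, Finset.mul_sum, ← Finset.sum_sub_distrib,
      hessian_gaussianBarrier]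
    exact Finset.sum_congr rfl fun i _ => Finset.sum_congr rfl fun j _ => by ring
  have hfirst : ∑ i, L.b z i * partialDeriv i (gaussianBarrier β y) z =
      gaussianBarrier β y z * (-2 * β * inner ℝ (z - y) (L.b z)) := by
    simp only [PiLp.inner_apply, Finset.mul_sum, partialDeriv_gaussianBarrier]
    refine Finset.sum_congr rfl fun i _ => ?_
    simp only [RCLike.inner_apply, conj_trivial]
    ring
  rw [apply, hsecond, hfirst]
  ring

lemma trace_le_of_principalSymbol_le {Λ : ℝ}
    (h : ∀ ξ : Rn n, L.principalSymbol z ξ ≤ Λ * ‖ξ‖ ^ 2) : (L.a z).trace ≤ n * Λ := by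
  have hdiag (i : Fin n) : L.a z i i ≤ Λ := by
    simpa [principalSymbol, Pi.single_apply] using h (EuclideanSpace.single i 1)
  simpa [Matrix.trace] using Finset.sum_le_sum fun i (_ : i ∈ Finset.univ) => hdiag i

lemma IsEllipticAt.apply_gaussianBarrier_lt (h : L.IsEllipticAt K z) (hβ : 0 < β)
    (hK : K * (n + ‖z - y‖) < 2 * β * ‖z - y‖ ^ 2) :
    L.apply (gaussianBarrier β y) z < L.c z * gaussianBarrier β y z := by
  obtain ⟨l, hl, hb, hsymbol⟩ := h
  have htrace : (L.a z).trace ≤ n * (K * l) :=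
    trace_le_of_principalSymbol_le fun ξ => (hsymbol ξ).2
  have hdrift : -inner ℝ (z - y) (L.b z) ≤ ‖z - y‖ * (K * l) :=
    calc -inner ℝ (z - y) (L.b z) ≤ |inner ℝ (z - y) (L.b z)| := neg_le_abs _
      _ ≤ ‖z - y‖ * ‖L.b z‖ := abs_real_inner_le_norm _ _
      _ ≤ ‖z - y‖ * (K * l) := by gcongr
  have hdominated : (L.a z).trace - inner ℝ (z - y) (L.b z) <
      2 * β * L.principalSymbol z (z - y) :=
    calc (L.a z).trace - inner ℝ (z - y) (L.b z) ≤ K * (n + ‖z - y‖) * l := by linarith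
      _ < 2 * β * ‖z - y‖ ^ 2 * l := by gcongr
      _ = 2 * β * (l * ‖z - y‖ ^ 2) := by ring
      _ ≤ 2 * β * L.principalSymbol z (z - y) := by gcongr; exact (hsymbol _).1
  have hgap : 0 < gaussianBarrier β y z * (2 * β) * (2 * β * L.principalSymbol z (z - y) -
      ((L.a z).trace - inner ℝ (z - y) (L.b z))) :=
    mul_pos (mul_pos (gaussianBarrier_pos β y z) (by positivity)) (sub_pos.2 hdominated)
  rw [L.apply_gaussianBarrier]
  linarith

/-- Hopf's comparison argument: on the sphere of radius `ρ` the bound follows from `w ≤ S`, near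
`y` from the gap `ε`, and in between the barrier excludes an interior maximum. -/
lemma add_smul_gaussianBarrier_le {S m s ρ ε : ℝ} (hm : 0 ≤ m) (hs : 0 ≤ s) (hβ : 0 < β)
    (hK : K * (n + ρ) < 2 * β * s ^ 2) (hε : 0 < ε) (hmS : m ≤ S - ε) (hc : ∀ x, 0 ≤ L.c x)
    (hell : ∀ x, m < w x → L.IsEllipticAt K x) (hsub : L.IsSubsolutionOn w {x | m < w x})
    (hw : ContinuousOn w (closedBall y ρ)) (hwS : ∀ x ∈ closedBall y ρ, w x ≤ S)
    (hgap : ∀ x ∈ ball y s, w x ≤ S - ε) :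
    ∀ x ∈ closedBall y ρ, w x + ε * gaussianBarrier β y x ≤ S + ε * Real.exp (-β * ρ ^ 2) := by
  intro x hx
  obtain ⟨z, hz, hzmax⟩ := (isCompact_closedBall y ρ).exists_isMaxOn ⟨x, hx⟩
    (hw.add (((contDiff_gaussianBarrier β y (k := 0)).continuous.const_smul ε).continuousOn))
  refine (hzmax hx).trans ?_
  simp only [Pi.add_apply, Pi.smul_apply, smul_eq_mul]
  by_contra! hlt
  have hG : ε * gaussianBarrier β y z ≤ ε :=
    mul_le_of_le_one_right hε.le (gaussianBarrier_le_one hβ.le y z)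
  have hexp : 0 ≤ ε * Real.exp (-β * ρ ^ 2) := by positivity
  have hfar : s ≤ ‖z - y‖ := by
    by_contra! hnear
    linarith [hgap z (mem_ball_iff_norm.2 hnear)]
  have hinside : ‖z - y‖ < ρ := by
    refine (mem_closedBall_iff_norm.1 hz).lt_of_ne fun hsphere => ?_
    rw [gaussianBarrier, hsphere] at hlt
    linarith [hwS z hz]
  have hmz : m < w z := by linarith
  have hz_ell := hell z hmz
  have hbarrier : L.apply (gaussianBarrier β y) z < L.c z * gaussianBarrier β y z := by
    refine hz_ell.apply_gaussianBarrier_lt hβ ?_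
    have := hz_ell.const_nonneg
    calc K * (n + ‖z - y‖) ≤ K * (n + ρ) := by gcongr
      _ < 2 * β * s ^ 2 := hK
      _ ≤ 2 * β * ‖z - y‖ ^ 2 := by gcongr
  have hscaled : L.apply (ε • gaussianBarrier β y) z < L.c z * (ε • gaussianBarrier β y) z := by
    rw [L.apply_const_smul, Pi.smul_apply, smul_eq_mul, mul_left_comm]
    gcongr
  exact not_isLocalMax_add (hsub z hmz).1
    ((contDiff_gaussianBarrier β y).const_smul ε).contDiffAt hz_ell.principalSymbol_nonneg
    (hsub z hmz).2 (mul_nonneg (hc z) (hm.trans hmz.le)) hscaled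
    (hzmax.isLocalMax (closedBall_mem_nhds_of_mem (mem_ball_iff_norm.2 hinside)))

/-- The gap `η` does not depend on the position, because neither the ellipticity nor the modulus of
continuity of `w` does. -/
lemma quantitative_strong_maximum_principle {S m R : ℝ} (hm : 0 ≤ m) (hmS : m < S) (hR : 0 < R)
    (hwS : ∀ x, w x ≤ S) (hw : UniformContinuous w) (hc : ∀ x, 0 ≤ L.c x)
    (hell : L.IsUniformlyEllipticOn {x | m < w x}) (hsub : L.IsSubsolutionOn w {x | m < w x}) :
    ∃ η, 0 < η ∧ ∀ x y, S - η < w x → dist x y ≤ R → m < w y := by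
  obtain ⟨K, hK⟩ := hell
  set ε := (S - m) / 2 with hε_def
  have hε : 0 < ε := half_pos (sub_pos.2 hmS)
  obtain ⟨s, hs, hws⟩ := Metric.uniformContinuous_iff.1 hw ε hε
  obtain ⟨β, hβ⟩ := exists_gt (max 0 (K * (n + 2 * R) / (2 * s ^ 2)))
  rw [max_lt_iff, div_lt_iff₀ (by positivity)] at hβ
  obtain ⟨hβ, hβK⟩ := hβ
  refine ⟨ε * (Real.exp (-β * R ^ 2) - Real.exp (-β * (2 * R) ^ 2)),
    mul_pos hε (sub_pos.2 (Real.exp_lt_exp.2 ?_)), fun x y hx hxy => ?_⟩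
  · linarith [show 0 < β * R ^ 2 by positivity]
  by_contra! hy
  have hgap : ∀ z ∈ ball y s, w z ≤ S - ε := fun z hz => by
    linarith [(abs_lt.1 (hws hz)).2]
  have hcomparison := add_smul_gaussianBarrier_le hm hs.le hβ (by linarith) hε (by linarith) hc hK
    hsub hw.continuous.continuousOn (fun z _ => hwS z) hgap x
    (mem_closedBall.2 (by linarith : dist x y ≤ 2 * R))
  have hbarrier : Real.exp (-β * R ^ 2) ≤ gaussianBarrier β y x := by
    rw [gaussianBarrier, ← dist_eq_norm, neg_mul, neg_mul]
    gcongr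
  linarith [mul_le_mul_of_nonneg_left hbarrier hε.le]

end SecondOrderOperator

end GaussianBarrier

section Gradient

lemma norm_gradient_eq_norm_fderiv {E : Type*} [NormedAddCommGroup E] [InnerProductSpace ℝ E]
    [CompleteSpace E] (u : E → ℝ) (x : E) : ‖gradient u x‖ = ‖fderiv ℝ u x‖ := by
  simp [gradient]

/-- The point is a minimum over the ball of `u` plus the paraboloid `2M ‖· - x‖² / R²`, which is
too high on the boundary sphere. -/
lemma exists_mem_ball_norm_fderiv_lt {E : Type*} [NormedAddCommGroup E] [InnerProductSpace ℝ E]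
    [ProperSpace E] {u : E → ℝ} {x : E} {M R : ℝ} (hR : 0 < R) (hu : DiffContOnCl ℝ u (ball x R))
    (hM : ∀ z ∈ closedBall x R, |u z| < M) :
    ∃ z ∈ ball x R, ‖fderiv ℝ u z‖ < 4 * M / R := by
  have hx : x ∈ closedBall x R := mem_closedBall_self hR.le
  have hM₀ : 0 < M := (abs_nonneg _).trans_lt (hM x hx)
  set κ := 2 * M / R ^ 2 with hκ_def
  have : 0 < κ := by positivity
  obtain ⟨z, hz, hzmin⟩ := (isCompact_closedBall x R).exists_isMinOn ⟨x, hx⟩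
    (hu.continuousOn_ball.add (f := u) (g := fun z => κ * ‖z - x‖ ^ 2) (by fun_prop))
  have hzx : u z + κ * ‖z - x‖ ^ 2 ≤ u x := by simpa using hzmin hx
  have hinside : ‖z - x‖ < R := by
    refine (mem_closedBall_iff_norm.1 hz).lt_of_ne fun hsphere => ?_
    rw [hsphere, hκ_def, div_mul_cancel₀ _ (by positivity)] at hzx
    linarith [(abs_lt.1 (hM x hx)).2, (abs_lt.1 (hM z hz)).1]
  have hzball : z ∈ ball x R := mem_ball_iff_norm.2 hinside
  refine ⟨z, hzball, ?_⟩
  have hparaboloid : HasFDerivAt (fun z => κ * ‖z - x‖ ^ 2) ((2 * κ) • innerSL ℝ (z - x)) z := by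
    refine (((hasFDerivAt_id z).sub_const x).norm_sq.const_mul κ).congr_fderiv ?_
    ext v
    simp only [id_eq, ContinuousLinearMap.comp_id, smul_apply, coe_innerSL_apply, nsmul_eq_mul,
      Nat.cast_ofNat, smul_eq_mul]
    ring
  have hcritical : fderiv ℝ u z = -((2 * κ) • innerSL ℝ (z - x)) :=
    eq_neg_of_add_eq_zero_left <|
      (hzmin.isLocalMin (closedBall_mem_nhds_of_mem hzball)).hasFDerivAt_eq_zero
        ((hu.differentiableAt isOpen_ball hzball).hasFDerivAt.add hparaboloid)
  calc ‖fderiv ℝ u z‖ = 2 * κ * ‖z - x‖ := by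
        rw [hcritical, norm_neg, norm_smul, innerSL_apply_norm, Real.norm_of_nonneg (by positivity)]
    _ < 2 * κ * R := by gcongr
    _ = 4 * M / R := by rw [hκ_def]; field_simp; ring

lemma exists_dist_le_norm_fderiv_lt_of_bounded {E : Type*} [NormedAddCommGroup E]
    [InnerProductSpace ℝ E] [ProperSpace E] {u : E → ℝ} (hu : Differentiable ℝ u)
    (hbdd : ∃ M, ∀ x, |u x| ≤ M) {δ : ℝ} (hδ : 0 < δ) :
    ∃ R, 0 < R ∧ ∀ x, ∃ z, dist x z ≤ R ∧ ‖fderiv ℝ u z‖ < δ := by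
  obtain ⟨M, hM⟩ := hbdd
  have hM₀ : 0 ≤ M := (abs_nonneg _).trans (hM 0)
  have hR : 0 < 4 * (M + 1) / δ := by positivity
  refine ⟨4 * (M + 1) / δ, hR, fun x => ?_⟩
  obtain ⟨z, hz, hlt⟩ := exists_mem_ball_norm_fderiv_lt (M := M + 1) hR
    (hu.diffContOnCl (s := ball x _)) fun z _ => (hM z).trans_lt (lt_add_one M)
  refine ⟨z, (mem_ball'.1 hz).le, hlt.trans_eq ?_⟩
  field_simp

lemma eq_of_norm_fderiv_le_mul_norm_sub {E F : Type*} [NormedAddCommGroup E] [NormedSpace ℝ E]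
    [NormedAddCommGroup F] [NormedSpace ℝ F] {u : E → F} (hu : Differentiable ℝ u) {C : ℝ} {x₀ : E}
    (h : ∀ x, ‖fderiv ℝ u x‖ ≤ C * ‖u x - u x₀‖) (x : E) : u x = u x₀ := by
  set γ : ℝ →ᵃ[ℝ] E := AffineMap.lineMap x₀ x with hγ_def
  have hderiv (t : ℝ) : HasDerivAt (fun t => u (γ t) - u x₀) (fderiv ℝ u (γ t) (x - x₀)) t :=
    ((hu _).hasFDerivAt.comp_hasDerivAt t AffineMap.hasDerivAt_lineMap).sub_const _
  have hbound (t : ℝ) : ‖fderiv ℝ u (γ t) (x - x₀)‖ ≤ C * ‖x - x₀‖ * ‖u (γ t) - u x₀‖ :=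
    calc ‖fderiv ℝ u (γ t) (x - x₀)‖ ≤ ‖fderiv ℝ u (γ t)‖ * ‖x - x₀‖ :=
          ContinuousLinearMap.le_opNorm _ _
      _ ≤ C * ‖u (γ t) - u x₀‖ * ‖x - x₀‖ := by gcongr; exact h _
      _ = C * ‖x - x₀‖ * ‖u (γ t) - u x₀‖ := by ring
  have hzero := eq_zero_of_abs_deriv_le_mul_abs_self_of_eq_zero_right (a := 0) (b := 1)
    (fun t _ => (hderiv t).continuousAt.continuousWithinAt)
    (fun t _ => (hderiv t).hasDerivWithinAt) (by simp [hγ_def]) (fun t _ => hbound t) 1 (by simp)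
  simpa [hγ_def, sub_eq_zero] using hzero

end Gradient

lemma exists_norm_le_mul_sq_of_fderiv_eq_zero {E F : Type*} [NormedAddCommGroup E]
    [NormedSpace ℝ E] [ProperSpace E] [NormedAddCommGroup F] [NormedSpace ℝ F] {f : E → F} {x₀ : E}
    (hf : ContDiff ℝ 2 f) (h₀ : f x₀ = 0) (h₁ : fderiv ℝ f x₀ = 0) (r : ℝ) :
    ∃ C, 0 ≤ C ∧ ∀ x ∈ closedBall x₀ r, ‖f x‖ ≤ C * ‖x - x₀‖ ^ 2 := by
  obtain ⟨C, hC⟩ := (hf.fderiv_right (m := 1) (by norm_num)).contDiffOn.exists_lipschitzOnWith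
    one_ne_zero (convex_closedBall x₀ r) (isCompact_closedBall x₀ r)
  refine ⟨C, C.2, fun x hx => ?_⟩
  have hr : ‖x - x₀‖ ≤ r := mem_closedBall_iff_norm.1 hx
  have hx₀ : x₀ ∈ closedBall x₀ r := mem_closedBall_self ((norm_nonneg _).trans hr)
  have hderiv : ∀ z ∈ closedBall x₀ ‖x - x₀‖, ‖fderiv ℝ f z‖ ≤ C * ‖x - x₀‖ := fun z hz => by
    have hlip := hC.norm_sub_le (closedBall_subset_closedBall hr hz) hx₀
    rw [h₁, sub_zero] at hlip
    exact hlip.trans (by gcongr; exact mem_closedBall_iff_norm.1 hz)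
  simpa [h₀, pow_two, mul_assoc] using
    (convex_closedBall x₀ ‖x - x₀‖).norm_image_sub_le_of_norm_fderiv_le
      (fun z _ => hf.differentiable two_ne_zero z) hderiv (mem_closedBall_self (norm_nonneg _))
      (mem_closedBall_iff_norm.2 le_rfl)

lemma exists_pos_forall_le_norm_of_lt {X E : Type*} [TopologicalSpace X]
    [SeminormedAddCommGroup E] {P : X → E → ℝ} {A : Set X} {m : ℝ} (hA : IsCompact A)
    (hP : Continuous fun z : X × E => P z.1 z.2) (hm : ∀ s ∈ A, P s 0 < m) :
    ∃ δ, 0 < δ ∧ ∀ s ∈ A, ∀ p, m < P s p → δ ≤ ‖p‖ := by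
  have hsmall : ∀ᶠ p in nhds (0 : E), ∀ s ∈ A, P s p < m :=
    hA.eventually_forall_of_forall_eventually fun s hs =>
      (hP.comp continuous_swap).continuousAt.eventually_lt_const (hm s hs)
  obtain ⟨δ, hδ, hball⟩ := Metric.eventually_nhds_iff.1 hsmall
  refine ⟨δ, hδ, fun s hs p hp => ?_⟩
  by_contra! hlt
  exact (hball (by simpa using hlt) s hs).not_gt hp

lemma StandingAssumption.uniformContinuous_gradient {n : ℕ} {u : Rn n → ℝ}
    (hu : StandingAssumption u) : UniformContinuous (gradient u) := by
  obtain ⟨α, K, hα, -, hholder⟩ := hu.holder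
  exact hholder.uniformContinuous hα

namespace IsPFunction

variable {n : ℕ} {u : Rn n → ℝ} {P : ℝ → Rn n → ℝ} {μ : ℝ → ℝ}

theorem nonpos (hP : IsPFunction u P μ) (hPcont : Continuous fun z : ℝ × Rn n => P z.1 z.2)
    (hP₀ : ∀ s, P s 0 ≤ 0) (hμ : ∀ t, 0 < t → 0 < μ t) (hu : Differentiable ℝ u)
    (hbdd : ∃ M, ∀ x, |u x| ≤ M) (hgrad_bdd : ∃ C, ∀ x, ‖gradient u x‖ ≤ C)
    (hgrad : UniformContinuous (gradient u)) (x : Rn n) : P (u x) (gradient u x) ≤ 0 := by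
  obtain ⟨-, hC2, L, hc, hell, hL⟩ := hP
  have ⟨M, hM⟩ := hbdd
  obtain ⟨C, hC⟩ := hgrad_bdd
  set w : Rn n → ℝ := fun y => P (u y) (gradient u y)
  have hucont : UniformContinuous u := by
    refine (lipschitzWith_of_nnnorm_fderiv_le (C := C.toNNReal) hu fun y => ?_).uniformContinuous
    rw [← norm_toNNReal, ← norm_gradient_eq_norm_fderiv]
    exact Real.toNNReal_le_toNNReal (hC y)
  have hmaps (y : Rn n) : (u y, gradient u y) ∈ Icc (-M) M ×ˢ closedBall (0 : Rn n) C :=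
    ⟨abs_le.1 (hM y), mem_closedBall_zero_iff.2 (hC y)⟩
  have hcompact : IsCompact (Icc (-M) M ×ˢ closedBall (0 : Rn n) C) :=
    isCompact_Icc.prod (isCompact_closedBall 0 C)
  have hw : UniformContinuous w := uniformContinuousOn_univ.1 <|
    (hcompact.uniformContinuousOn_of_continuous hPcont.continuousOn).comp
      (hucont.prodMk hgrad).uniformContinuousOn fun y _ => hmaps y
  have hw_bdd : BddAbove (range w) := by
    refine (hcompact.image hPcont).bddAbove.mono (range_subset_iff.2 fun y => ?_)
    exact mem_image_of_mem (fun z : ℝ × Rn n => P z.1 z.2) (hmaps y)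
  by_contra! hpos
  set S := ⨆ y, w y
  have hS : 0 < S := hpos.trans_le (le_ciSup hw_bdd x)
  obtain ⟨δ, hδ, hδP⟩ := exists_pos_forall_le_norm_of_lt (m := S / 2) (A := Icc (-M) M)
    isCompact_Icc hPcont fun s _ => (hP₀ s).trans_lt (half_pos hS)
  have hδw (y : Rn n) (hy : S / 2 < w y) : δ ≤ ‖gradient u y‖ := hδP _ (hmaps y).1 _ hy
  have hsub : L.IsSubsolutionOn w {y | S / 2 < w y} := fun y hy =>
    have hμy := hμ _ (hδ.trans_le (hδw y hy))
    ⟨hC2 y hμy, nonpos_of_mul_nonpos_right (hL y) hμy⟩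
  obtain ⟨R, hR, hR_small⟩ := exists_dist_le_norm_fderiv_lt_of_bounded hu hbdd hδ
  obtain ⟨η, hη, hlarge⟩ := SecondOrderOperator.quantitative_strong_maximum_principle
    (half_pos hS).le (half_lt_self hS) hR (le_ciSup hw_bdd) hw hc
    ((hell δ hδ).imp fun K hK y hy => hK y (hδw y hy)) hsub
  obtain ⟨y, hy⟩ := exists_lt_of_lt_ciSup (sub_lt_self S hη)
  obtain ⟨z, hz, hzδ⟩ := hR_small y
  rw [← norm_gradient_eq_norm_fderiv] at hzδ
  exact (hδw z (hlarge y z hy hz)).not_gt hzδ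

theorem sq_norm_gradient_le {B Γ Ψ : ℝ → ℝ}
    (hP : IsPFunction u (fun s p => B (‖p‖ ^ 2) - Γ s) μ) (hB : ContinuousOn B (Ici 0))
    (hBmono : StrictMonoOn B (Ici 0)) (hΨ₀ : ∀ s, 0 ≤ Ψ s) (hΨ : ∀ s, B (Ψ s) = Γ s)
    (hΨcont : Continuous Ψ) (hμ : ∀ t, 0 < t → 0 < μ t)
    (hu : Differentiable ℝ u) (hbdd : ∃ M, ∀ x, |u x| ≤ M)
    (hgrad_bdd : ∃ C, ∀ x, ‖gradient u x‖ ≤ C) (hgrad : UniformContinuous (gradient u))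
    (x : Rn n) : ‖gradient u x‖ ^ 2 ≤ Ψ (u x) := by
  obtain rfl : (fun s => B (Ψ s)) = Γ := funext hΨ
  have hcont : Continuous fun z : ℝ × Rn n => B (‖z.2‖ ^ 2) - B (Ψ z.1) :=
    (hB.comp_continuous (continuous_snd.norm.pow 2) fun z => sq_nonneg ‖z.2‖).sub
      (hB.comp_continuous (hΨcont.comp continuous_fst) fun z => hΨ₀ z.1)
  have hzero (s : ℝ) : B (‖(0 : Rn n)‖ ^ 2) - B (Ψ s) ≤ 0 := by
    simpa using hBmono.monotoneOn self_mem_Ici (hΨ₀ s) (hΨ₀ s)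
  have hle := hP.nonpos hcont hzero hμ hu hbdd hgrad_bdd hgrad x
  exact (hBmono.le_iff_le (mem_Ici.2 (sq_nonneg _)) (hΨ₀ _)).1 (sub_nonpos.1 hle)

end IsPFunction

theorem mainTheorem5_general {n : ℕ} {u : Rn n → ℝ} {B Γ Ψ μ : ℝ → ℝ} {x₀ : Rn n}
    (hu : Differentiable ℝ u) (hbdd : ∃ M, ∀ x, |u x| ≤ M)
    (hgrad_bdd : ∃ C, ∀ x, ‖gradient u x‖ ≤ C) (hgrad : UniformContinuous (gradient u))
    (hB : ContinuousOn B (Ici 0)) (hBmono : StrictMonoOn B (Ici 0)) (hB₀ : B 0 = 0)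
    (hΨ₀ : ∀ s, 0 ≤ Ψ s) (hΨ : ∀ s, B (Ψ s) = Γ s) (hΨdiff : ContDiff ℝ 2 Ψ)
    (hμ : ∀ t, 0 < t → 0 < μ t) (hP : IsPFunction u (fun s p => B (‖p‖ ^ 2) - Γ s) μ)
    (hx₀ : Γ (u x₀) = 0) : ∀ x, u x = u x₀ := by
  have hΨx₀ : Ψ (u x₀) = 0 :=
    hBmono.injOn (hΨ₀ _) self_mem_Ici (by rw [hΨ, hx₀, hB₀])
  have hcritical : fderiv ℝ Ψ (u x₀) = 0 :=
    IsLocalMin.fderiv_eq_zero (Filter.Eventually.of_forall fun s => hΨx₀.trans_le (hΨ₀ s))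
  have ⟨M, hM⟩ := hbdd
  obtain ⟨C, hC, hCΨ⟩ := exists_norm_le_mul_sq_of_fderiv_eq_zero hΨdiff hΨx₀ hcritical (2 * M)
  have hmem (x : Rn n) : u x ∈ closedBall (u x₀) (2 * M) := by
    rw [mem_closedBall_iff_norm, two_mul]
    exact (norm_sub_le _ _).trans (add_le_add (hM x) (hM x₀))
  refine eq_of_norm_fderiv_le_mul_norm_sub (C := √C) hu fun x => ?_
  rw [← norm_gradient_eq_norm_fderiv]
  refine le_of_sq_le_sq ?_ (by positivity)
  calc ‖gradient u x‖ ^ 2 ≤ Ψ (u x) :=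
        hP.sq_norm_gradient_le hB hBmono hΨ₀ hΨ hΨdiff.continuous hμ hu hbdd hgrad_bdd hgrad x
    _ ≤ ‖Ψ (u x)‖ := Real.le_norm_self _
    _ ≤ C * ‖u x - u x₀‖ ^ 2 := hCΨ _ (hmem x)
    _ = (√C * ‖u x - u x₀‖) ^ 2 := by rw [mul_pow, Real.sq_sqrt hC]

theorem mainTheorem5 (n : ℕ)
    (F : ℝ × Rn n × Matrix (Fin n) (Fin n) ℝ → ℝ) (hF : Continuous F)
    (u : Rn n → ℝ) (hsol : IsEntireSolution F u) (hu : StandingAssumption u)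
    (B Γ μ : ℝ → ℝ)
    (hBcont : ContinuousOn B (Set.Ici 0)) (hBdiff : ContDiffOn ℝ 2 B (Set.Ioi 0))
    (hB' : ∀ t, 0 < t → 0 < deriv B t) (hB'' : ∀ t, 0 < t → 0 ≤ deriv (deriv B) t)
    (hB0 : B 0 = 0) (hΓ : ∀ s, 0 ≤ Γ s)
    -- `Ψ = B⁻¹ ∘ Γ` is of class `C²`
    (Ψ : ℝ → ℝ) (hΨ0 : ∀ s, 0 ≤ Ψ s) (hΨ : ∀ s, B (Ψ s) = Γ s) (hΨdiff : ContDiff ℝ 2 Ψ)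
    (hμ : ∀ t, 0 < t → 0 < μ t)
    (hP : IsPFunction u (fun s p => B (‖p‖ ^ 2) - Γ s) μ)
    (x₀ : Rn n) (hx₀ : Γ (u x₀) = 0) :
    ∃ k : ℝ, ∀ x, u x = k :=
  ⟨u x₀, mainTheorem5_general (hu.contDiff.differentiable two_ne_zero) hu.bounded
    (hu.gradient_bounded.imp fun _ => And.right) hu.uniformContinuous_gradient hBcont
    (strictMonoOn_of_deriv_pos (convex_Ici 0) hBcont (by simpa using hB')) hB0 hΨ0 hΨ hΨdiff hμ hP
    hx₀⟩
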